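/- Graphs are finite, undirected, without loops or multiple edges. The symmetric orientation $G_s$ of a graph $G$ is obtained by replacing each edge by a pair of opposite arcs. An oriented perfect path double cover (OPPDC) of $G$ is a collection of directed paths in $G_s$ (paths of length zero are allowed) such that each arc of $G_s$ lies in exactly one of the paths and each vertex of $G$ appears exactly once as the beginning and exactly once as the end of a path. A block of $G$ is a maximal connected subgraph that has no cut vertex of its own, and $G$ is a block graph if each of its blocks is a clique. Corollary. Every block graph none of whose connected components is isomorphic to $K_3$ or $K_5$ has an OPPDC. In particular, every connected block graph other than $K_3$ and $K_5$ has an OPPDC. -/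

import Mathlib

namespace SimpleGraph

/-- A directed path in the symmetric orientation of `G`, i.e. a path of `G` traversed from its
first vertex `start` to its last vertex `finish`. Length zero is allowed. The arcs it uses are the
darts of the walk; the darts of `G` are the arcs of the symmetric orientation. -/
structure DirectedPath {V : Type*} (G : SimpleGraph V) where
  start : V
  finish : V
  walk : G.Walk start finish
  isPath : walk.IsPath

/-- A set `P` of directed paths is an oriented perfect path double cover of `G`: every arc of the
symmetric orientation lies in exactly one of the paths, and every vertex is the beginning of
exactly one of the paths and the end of exactly one of the paths. -/
structure IsOPPDC {V : Type*} (G : SimpleGraph V) (P : Set G.DirectedPath) : Prop where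
  existsUnique_arc : ∀ d : G.Dart, ∃! p : G.DirectedPath, p ∈ P ∧ d ∈ p.walk.darts
  existsUnique_start : ∀ v : V, ∃! p : G.DirectedPath, p ∈ P ∧ p.start = v
  existsUnique_finish : ∀ v : V, ∃! p : G.DirectedPath, p ∈ P ∧ p.finish = v

/-- `G` has an oriented perfect path double cover. -/
def HasOPPDC {V : Type*} (G : SimpleGraph V) : Prop :=
  ∃ P : Set G.DirectedPath, G.IsOPPDC P

/-- `v` is a cut vertex of `G`: deleting `v` separates two vertices lying in the same connected
component of `G`. -/
def IsCutVertex {V : Type*} (G : SimpleGraph V) (v : V) : Prop :=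
  ∃ a b : ({v}ᶜ : Set V), G.Reachable a b ∧ ¬ (G.induce ({v}ᶜ : Set V)).Reachable a b

/-- A block of `G`: a maximal connected subgraph that has no cut vertex of its own. -/
def IsBlock {V : Type*} (G : SimpleGraph V) (B : G.Subgraph) : Prop :=
  Maximal (fun H : G.Subgraph => H.coe.Connected ∧ ∀ v, ¬ H.coe.IsCutVertex v) B

/-- A block graph: every block is a clique. -/
def IsBlockGraph {V : Type*} (G : SimpleGraph V) : Prop :=
  ∀ B : G.Subgraph, G.IsBlock B → G.IsClique B.verts

end SimpleGraph

/-! A cut vertex `v` splits a connected block graph into two smaller ones that share only `v`, so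
the proof glues covers at `v`. Paths are lists of vertices. If the same number of paths is cut open
at `v` on both sides, each piece ending at `v` can be continued by a piece that starts at `v` on the
other side; the result repeats no vertex (`HasPieceCover.join`). Only the count of ends at `v` needs
care: each side supplies the ends at its other vertices, and exactly one side also supplies those at
`v`.

The induction stops at connected sets without cut vertex, which are cliques. A clique whose order is
not 3 or 5 has a cover (`hasCover_offDiag`). For even order these are the translates of a zigzag
path in `ZMod (2 * k)`. For odd order at least 7, a point at infinity closes the translates into `2
* k` cycles. A spanning path that takes one arc from each cycle, together with the cycles opened at
these arcs, is a cover (`hasCover_of_transversal`).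

For orders 3 and 5 explicit cut-open families are used (`hasPieceCover_offDiag`). They allow gluing
to a covered set and to each other, so a union at a cut vertex always has a cover
(`hasCover_union`). Hence a component without a cover can only be a clique of order 3 or 5
(`hasCover_of_isConn`). -/

namespace PathCover

/-! ### Paths as lists, covers and cut-open covers -/

variable {V W : Type*}

/-- The pairs of consecutive entries of a list. -/
def arcs (l : List V) : List (V × V) := l.zip l.tail

@[simp] lemma arcs_nil : arcs ([] : List V) = [] := rfl

@[simp] lemma arcs_singleton (v : V) : arcs [v] = [] := rfl

@[simp] lemma arcs_cons_cons (u v : V) (l : List V) :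
    arcs (u :: v :: l) = (u, v) :: arcs (v :: l) := rfl

lemma arcs_append_cons (A : List V) (v : V) (B : List V) :
    arcs (A ++ v :: B) = arcs (A ++ [v]) ++ arcs (v :: B) := by
  induction A with
  | nil => simp
  | cons a A ih => cases A with
    | nil => simp
    | cons b A => simpa using ih

lemma arcs_map (f : V → W) (l : List V) : arcs (l.map f) = (arcs l).map (Prod.map f f) := by
  rw [arcs, ← List.map_tail, List.zip_map, arcs]

@[simp] lemma length_arcs (l : List V) : (arcs l).length = l.length - 1 := by
  simp [arcs]

lemma exists_append_of_mem_arcs {l : List V} {x y : V} (h : (x, y) ∈ arcs l) :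
    ∃ A B, l = A ++ x :: y :: B := by
  induction l with
  | nil => simp at h
  | cons a l ih => cases l with
    | nil => simp at h
    | cons b l =>
      rw [arcs_cons_cons, List.mem_cons] at h
      rcases h with h | h
      · obtain ⟨rfl, rfl⟩ := Prod.mk.inj h
        exact ⟨[], l, rfl⟩
      · obtain ⟨A, B, hAB⟩ := ih h
        exact ⟨a :: A, B, by simp [hAB]⟩

lemma isChain_iff_forall_mem_arcs {r : V → V → Prop} {l : List V} :
    l.IsChain r ↔ ∀ e ∈ arcs l, r e.1 e.2 := by
  induction l with
  | nil => simp
  | cons a l ih => cases l with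
    | nil => simp
    | cons b l => simp [ih]

/-- A multiset `F` of lists without repetition, with entries in `S`, whose consecutive pairs make up
`A` and such that every vertex of `S` is exactly once a first and exactly once a last entry. -/
structure IsCover (S : Finset V) (A : Multiset (V × V)) (F : Multiset (List V)) : Prop where
  nodup : ∀ l ∈ F, l.Nodup
  subset : ∀ l ∈ F, ∀ x ∈ l, x ∈ S
  arcs_eq : F.bind (fun l => (arcs l : Multiset (V × V))) = A
  heads_eq : F.map List.head? = S.val.map some
  lasts_eq : F.map List.getLast? = S.val.map some

/-- There is a multiset of lists as in `IsCover`. -/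
def HasCover (S : Finset V) (A : Multiset (V × V)) : Prop := ∃ F, IsCover S A F

/-- Paths with consecutive pairs `A`, some of them being cut open at `v`: the paths `ins` lack their
continuation after `v` and the paths `outs` lack their part before `v`. The remaining first and last
vertices both make up `T`. -/
structure IsPieceCover (v : V) (S : Finset V) (T : Multiset V) (A : Multiset (V × V)) {m : ℕ}
    (ins outs : Fin m → List V) (F : Multiset (List V)) : Prop where
  ins_nodup : ∀ i, (ins i).Nodup
  outs_nodup : ∀ i, (outs i).Nodup
  nodup : ∀ l ∈ F, l.Nodup
  ins_subset : ∀ i, ∀ x ∈ ins i, x ∈ S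
  outs_subset : ∀ i, ∀ x ∈ outs i, x ∈ S
  subset : ∀ l ∈ F, ∀ x ∈ l, x ∈ S
  ins_getLast : ∀ i, (ins i).getLast? = some v
  outs_head : ∀ i, (outs i).head? = some v
  arcs_eq : Finset.univ.val.bind (fun i => (arcs (ins i) : Multiset (V × V))) +
    Finset.univ.val.bind (fun i => (arcs (outs i) : Multiset (V × V))) +
    F.bind (fun l => (arcs l : Multiset (V × V))) = A
  heads_eq : Finset.univ.val.map (fun i => (ins i).head?) + F.map List.head? = T.map some
  lasts_eq : Finset.univ.val.map (fun i => (outs i).getLast?) + F.map List.getLast? = T.map some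

/-- There are lists as in `IsPieceCover`, with `m` paths cut open. -/
def HasPieceCover (v : V) (S : Finset V) (T : Multiset V) (A : Multiset (V × V)) (m : ℕ) : Prop :=
  ∃ (ins outs : Fin m → List V) (F : Multiset (List V)), IsPieceCover v S T A ins outs F

/-! ### Gluing at a common vertex -/

section Join

variable {v : V} {p q : List V}

lemma head?_join (hp : p.getLast? = some v) : (p ++ q.tail).head? = p.head? := by
  cases p <;> simp_all

lemma getLast?_join (hp : p.getLast? = some v) (hq : q.head? = some v) :
    (p ++ q.tail).getLast? = q.getLast? := by
  obtain ⟨p, rfl⟩ := List.getLast?_eq_some_iff.1 hp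
  obtain ⟨q, rfl⟩ := List.head?_eq_some_iff.1 hq
  simp [List.getLast?_append, List.getLast?_cons]

lemma arcs_join (hp : p.getLast? = some v) (hq : q.head? = some v) :
    arcs (p ++ q.tail) = arcs p ++ arcs q := by
  obtain ⟨p, rfl⟩ := List.getLast?_eq_some_iff.1 hp
  obtain ⟨q, rfl⟩ := List.head?_eq_some_iff.1 hq
  simpa using arcs_append_cons p v q

lemma nodup_join [DecidableEq V] {S T : Finset V} (hST : S ∩ T = {v}) (hp : p.Nodup) (hq : q.Nodup)
    (hpS : ∀ x ∈ p, x ∈ S) (hqT : ∀ x ∈ q, x ∈ T) (hqv : q.head? = some v) :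
    (p ++ q.tail).Nodup := by
  obtain ⟨q, rfl⟩ := List.head?_eq_some_iff.1 hqv
  rw [List.nodup_cons] at hq
  refine List.nodup_append.2 ⟨hp, hq.2, fun a ha b hb hab => ?_⟩
  subst hab
  have : a ∈ S ∩ T := Finset.mem_inter.2 ⟨hpS a ha, hqT a (List.mem_of_mem_tail hb)⟩
  rw [hST, Finset.mem_singleton] at this
  subst this
  exact hq.1 hb

end Join

/-- Each incoming piece is continued by the outgoing piece of the same index on the other side. A
joined path begins where its incoming piece does and ends where its outgoing piece does, so the
multisets of ends simply add up. -/
theorem HasPieceCover.join [DecidableEq V] {v : V} {S₁ S₂ : Finset V} {T₁ T₂ : Multiset V}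
    {A₁ A₂ : Multiset (V × V)} {m : ℕ} (h₁ : HasPieceCover v S₁ T₁ A₁ m)
    (h₂ : HasPieceCover v S₂ T₂ A₂ m) (hS : S₁ ∩ S₂ = {v}) (hT : T₁ + T₂ = (S₁ ∪ S₂).val) :
    HasCover (S₁ ∪ S₂) (A₁ + A₂) := by
  obtain ⟨p₁, q₁, F₁, h₁⟩ := h₁
  obtain ⟨p₂, q₂, F₂, h₂⟩ := h₂
  have hS' : S₂ ∩ S₁ = {v} := by rw [Finset.inter_comm, hS]
  refine ⟨F₁ + F₂ + Finset.univ.val.map (fun i => p₁ i ++ (q₂ i).tail) +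
    Finset.univ.val.map (fun i => p₂ i ++ (q₁ i).tail), ?_, ?_, ?_, ?_, ?_⟩
  · intro l hl
    simp only [Multiset.mem_add, Multiset.mem_map, Finset.mem_val, Finset.mem_univ, true_and] at hl
    rcases hl with ((hl | hl) | ⟨i, rfl⟩) | ⟨i, rfl⟩
    · exact h₁.nodup l hl
    · exact h₂.nodup l hl
    · exact nodup_join hS (h₁.ins_nodup i) (h₂.outs_nodup i) (h₁.ins_subset i) (h₂.outs_subset i)
        (h₂.outs_head i)
    · exact nodup_join hS' (h₂.ins_nodup i) (h₁.outs_nodup i) (h₂.ins_subset i) (h₁.outs_subset i)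
        (h₁.outs_head i)
  · intro l hl x hx
    simp only [Multiset.mem_add, Multiset.mem_map, Finset.mem_val, Finset.mem_univ, true_and] at hl
    rw [Finset.mem_union]
    rcases hl with ((hl | hl) | ⟨i, rfl⟩) | ⟨i, rfl⟩
    · exact .inl (h₁.subset l hl x hx)
    · exact .inr (h₂.subset l hl x hx)
    · rcases List.mem_append.1 hx with hx | hx
      · exact .inl (h₁.ins_subset i x hx)
      · exact .inr (h₂.outs_subset i x (List.mem_of_mem_tail hx))
    · rcases List.mem_append.1 hx with hx | hx
      · exact .inr (h₂.ins_subset i x hx)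
      · exact .inl (h₁.outs_subset i x (List.mem_of_mem_tail hx))
  · simp only [Multiset.add_bind, Multiset.bind_map, ← h₁.arcs_eq, ← h₂.arcs_eq,
      arcs_join (h₁.ins_getLast _) (h₂.outs_head _), arcs_join (h₂.ins_getLast _) (h₁.outs_head _),
      ← Multiset.coe_add, Multiset.bind_add]
    abel
  · simp only [Multiset.map_add, Multiset.map_map, Function.comp_def, ← hT, ← h₁.heads_eq,
      ← h₂.heads_eq, head?_join (h₁.ins_getLast _), head?_join (h₂.ins_getLast _)]
    abel
  · simp only [Multiset.map_add, Multiset.map_map, Function.comp_def, ← hT, ← h₁.lasts_eq,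
      ← h₂.lasts_eq, getLast?_join (h₁.ins_getLast _) (h₂.outs_head _),
      getLast?_join (h₂.ins_getLast _) (h₁.outs_head _)]
    abel

/-- Covers of disjoint vertex sets. -/
theorem HasCover.disjUnion [DecidableEq V] {S₁ S₂ : Finset V} {A₁ A₂ : Multiset (V × V)}
    (h₁ : HasCover S₁ A₁) (h₂ : HasCover S₂ A₂) (hS : Disjoint S₁ S₂) :
    HasCover (S₁ ∪ S₂) (A₁ + A₂) := by
  obtain ⟨F₁, h₁⟩ := h₁
  obtain ⟨F₂, h₂⟩ := h₂
  have hval : (S₁ ∪ S₂).val = S₁.val + S₂.val := by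
    rw [← Finset.disjUnion_eq_union _ _ hS, Finset.disjUnion_val]
  refine ⟨F₁ + F₂, ?_, ?_, ?_, ?_, ?_⟩
  · intro l hl
    exact (Multiset.mem_add.1 hl).elim (h₁.nodup l) (h₂.nodup l)
  · intro l hl x hx
    exact (Multiset.mem_add.1 hl).elim (fun h => Finset.mem_union_left _ (h₁.subset l h x hx))
      (fun h => Finset.mem_union_right _ (h₂.subset l h x hx))
  · rw [Multiset.add_bind, h₁.arcs_eq, h₂.arcs_eq]
  · rw [hval, Multiset.map_add, Multiset.map_add, h₁.heads_eq, h₂.heads_eq]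
  · rw [hval, Multiset.map_add, Multiset.map_add, h₁.lasts_eq, h₂.lasts_eq]

theorem HasCover.map {S : Finset V} {A : Multiset (V × V)} (h : HasCover S A) (f : V ↪ W) :
    HasCover (S.map f) (A.map (Prod.map f f)) := by
  obtain ⟨F, h⟩ := h
  refine ⟨F.map (List.map f), ?_, ?_, ?_, ?_, ?_⟩
  · intro l hl
    obtain ⟨l, hl', rfl⟩ := Multiset.mem_map.1 hl
    exact (h.nodup l hl').map f.injective
  · intro l hl x hx
    obtain ⟨l, hl', rfl⟩ := Multiset.mem_map.1 hl
    obtain ⟨x, hx', rfl⟩ := List.mem_map.1 hx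
    exact Finset.mem_map_of_mem f (h.subset l hl' x hx')
  · simp only [Multiset.bind_map, arcs_map, ← h.arcs_eq, Multiset.map_bind, Multiset.map_coe]
  · have := congrArg (Multiset.map (Option.map f)) h.heads_eq
    simpa [Multiset.map_map, Function.comp_def] using this
  · have := congrArg (Multiset.map (Option.map f)) h.lasts_eq
    simpa [Multiset.map_map, Function.comp_def] using this

theorem HasPieceCover.map {v : V} {S : Finset V} {T : Multiset V} {A : Multiset (V × V)} {m : ℕ}
    (h : HasPieceCover v S T A m) (f : V ↪ W) :
    HasPieceCover (f v) (S.map f) (T.map f) (A.map (Prod.map f f)) m := by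
  obtain ⟨p, q, F, h⟩ := h
  refine ⟨fun i => (p i).map f, fun i => (q i).map f, F.map (List.map f), ?_, ?_, ?_, ?_, ?_, ?_,
    ?_, ?_, ?_, ?_, ?_⟩
  · exact fun i => (h.ins_nodup i).map f.injective
  · exact fun i => (h.outs_nodup i).map f.injective
  · intro l hl
    obtain ⟨l, hl', rfl⟩ := Multiset.mem_map.1 hl
    exact (h.nodup l hl').map f.injective
  · intro i x hx
    obtain ⟨x, hx', rfl⟩ := List.mem_map.1 hx
    exact Finset.mem_map_of_mem f (h.ins_subset i x hx')
  · intro i x hx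
    obtain ⟨x, hx', rfl⟩ := List.mem_map.1 hx
    exact Finset.mem_map_of_mem f (h.outs_subset i x hx')
  · intro l hl x hx
    obtain ⟨l, hl', rfl⟩ := Multiset.mem_map.1 hl
    obtain ⟨x, hx', rfl⟩ := List.mem_map.1 hx
    exact Finset.mem_map_of_mem f (h.subset l hl' x hx')
  · simp [h.ins_getLast]
  · simp [h.outs_head]
  · simp only [Multiset.bind_map, arcs_map, ← h.arcs_eq, Multiset.map_bind, Multiset.map_coe,
      Multiset.map_add]
  · have := congrArg (Multiset.map (Option.map f)) h.heads_eq
    simpa [Multiset.map_map, Function.comp_def] using this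
  · have := congrArg (Multiset.map (Option.map f)) h.lasts_eq
    simpa [Multiset.map_map, Function.comp_def] using this

/-- A cover can be cut open at a vertex that is not isolated. -/
theorem HasCover.hasPieceCover [DecidableEq V] {S : Finset V} {A : Multiset (V × V)}
    (h : HasCover S A) {v w : V} (hv : v ∈ S) (hvw : (v, w) ∈ A) :
    HasPieceCover v S (S.erase v).val A 1 := by
  obtain ⟨F, h⟩ := h
  have some_inj : Function.Injective (some : V → Option V) := Option.some_injective V
  have erase_map : ∀ M : Multiset (Option V), some v ::ₘ M = S.val.map some →
      M = (S.erase v).val.map some := by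
    intro M hM
    rw [Finset.erase_val, Multiset.map_erase some some_inj, ← hM, Multiset.erase_cons_head]
  obtain ⟨p, hp, hpv⟩ : ∃ p ∈ F, p.head? = some v := by
    rw [← Multiset.mem_map, h.heads_eq]
    exact Multiset.mem_map_of_mem _ hv
  obtain ⟨q, hq, hqv⟩ : ∃ q ∈ F, q.getLast? = some v := by
    rw [← Multiset.mem_map, h.lasts_eq]
    exact Multiset.mem_map_of_mem _ hv
  by_cases hpq : p = q
  -- A path without repetition from `v` to `v` is `[v]`. It is dropped, which removes the ends at
  -- `v`, and the path through the arc `(v, w)` is cut open instead.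
  · subst hpq
    have hpv' : p = [v] := by
      obtain ⟨l, rfl⟩ := List.head?_eq_some_iff.1 hpv
      have hn := h.nodup _ hp
      rcases List.eq_nil_or_concat l with rfl | ⟨l, x, rfl⟩
      · rfl
      · have : x = v := by simpa [List.getLast?_cons] using hqv
        subst this
        simp at hn
    subst hpv'
    obtain ⟨F, rfl⟩ := Multiset.exists_cons_of_mem hp
    rw [← h.arcs_eq, Multiset.mem_bind] at hvw
    obtain ⟨l, hl, hvw⟩ := hvw
    have hl' : l ∈ F := by
      rcases Multiset.mem_cons.1 hl with rfl | hl
      · simp at hvw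
      · exact hl
    obtain ⟨B, C, rfl⟩ := exists_append_of_mem_arcs (Multiset.mem_coe.1 hvw)
    obtain ⟨F, rfl⟩ := Multiset.exists_cons_of_mem hl'
    have hn := h.nodup _ hl
    have hs := h.subset _ hl
    refine ⟨fun _ => B ++ [v], fun _ => v :: w :: C, F, ?_, ?_, ?_, ?_, ?_, ?_, ?_, ?_, ?_, ?_, ?_⟩
    · intro i
      refine hn.sublist ?_
      simp
    · intro i
      exact hn.sublist (List.sublist_append_right _ _)
    · exact fun l hl => h.nodup l (by simp [hl])
    · intro i x hx
      refine hs x ?_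
      simp only [List.mem_append, List.mem_cons, List.not_mem_nil, or_false] at hx ⊢
      tauto
    · exact fun i x hx => hs x (List.mem_append_right _ hx)
    · exact fun l hl => h.subset l (by simp [hl])
    · simp
    · simp
    · rw [← h.arcs_eq]
      simp [arcs_append_cons B v (w :: C), ← Multiset.coe_add, add_assoc]
    · apply erase_map
      rw [← h.heads_eq]
      cases B <;> simp
    · apply erase_map
      rw [← h.lasts_eq]
      simp [List.getLast?_append, List.getLast?_cons]
  -- Otherwise the path ending at `v` serves as incoming piece and the path starting at `v` as
  -- outgoing piece; their ends at `v` are then no longer counted.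
  · obtain ⟨F, rfl⟩ := Multiset.exists_cons_of_mem hp
    have hq' : q ∈ F := by simpa [Ne.symm hpq] using hq
    obtain ⟨F, rfl⟩ := Multiset.exists_cons_of_mem hq'
    refine ⟨fun _ => q, fun _ => p, F, fun _ => h.nodup q hq, fun _ => h.nodup p hp,
      fun l hl => h.nodup l (by simp [hl]), fun _ => h.subset q hq, fun _ => h.subset p hp,
      fun l hl => h.subset l (by simp [hl]), fun _ => hqv, fun _ => hpv, ?_, ?_, ?_⟩
    · rw [← h.arcs_eq]
      simp only [Finset.univ_unique, Finset.singleton_val, Multiset.singleton_bind,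
        Multiset.cons_bind]
      abel
    · apply erase_map
      rw [← h.heads_eq]
      simp [hpv]
    · apply erase_map
      rw [← h.lasts_eq]
      simp [hqv, Multiset.cons_swap]

/-- The trivial path `[v]` restores the missing beginning and end at `v` without using an arc. -/
theorem HasPieceCover.insert_trivial [DecidableEq V] {S : Finset V} {A : Multiset (V × V)} {v : V}
    {m : ℕ} (h : HasPieceCover v S (S.erase v).val A m) (hv : v ∈ S) :
    HasPieceCover v S S.val A m := by
  obtain ⟨p, q, F, h⟩ := h
  have hS : S.val = v ::ₘ (S.erase v).val := by
    rw [Finset.erase_val, Multiset.cons_erase hv]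
  refine ⟨p, q, [v] ::ₘ F, h.ins_nodup, h.outs_nodup, ?_, h.ins_subset, h.outs_subset, ?_,
    h.ins_getLast, h.outs_head, ?_, ?_, ?_⟩
  · simpa using h.nodup
  · simpa [hv] using h.subset
  · simpa using h.arcs_eq
  · rw [hS, Multiset.map_cons, Multiset.map_cons, ← h.heads_eq]
    simp
  · rw [hS, Multiset.map_cons, Multiset.map_cons, ← h.lasts_eq]
    simp

end PathCover

/-! ### Complete graphs: spanning paths and transversals of cycles -/

namespace PathCover

variable {V W : Type*}

lemma offDiag_map [DecidableEq V] [DecidableEq W] (S : Finset V) (f : V ↪ W) :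
    S.offDiag.val.map (Prod.map f f) = (S.map f).offDiag.val := by
  have : (S.map f).offDiag = S.offDiag.map (f.prodMap f) := by
    ext ⟨x, y⟩
    simp only [Finset.mem_offDiag, Finset.mem_map, Function.Embedding.coe_prodMap, Prod.exists,
      Prod.map_apply, Prod.mk.injEq]
    constructor
    · rintro ⟨⟨a, ha, rfl⟩, ⟨b, hb, rfl⟩, hab⟩
      exact ⟨a, b, ⟨ha, hb, fun h => hab (congrArg f h)⟩, rfl, rfl⟩
    · rintro ⟨a, b, ⟨ha, hb, hab⟩, rfl, rfl⟩
      exact ⟨⟨a, ha, rfl⟩, ⟨b, hb, rfl⟩, fun h => hab (f.injective h)⟩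
  rw [this]
  rfl

lemma mem_arcs_map_range (f : ℕ → V) {n j : ℕ} (hj : j + 1 < n) :
    (f j, f (j + 1)) ∈ arcs ((List.range n).map f) := by
  rw [List.mem_iff_getElem]
  exact ⟨j, by simp; omega, by simp [arcs]⟩

lemma map_range_nodup {f : ℕ → V} {n : ℕ} (hf : Set.InjOn f (Set.Iio n)) :
    ((List.range n).map f).Nodup :=
  List.Nodup.map_on (fun x hx y hy h => hf (by simpa using hx) (by simpa using hy) h)
    List.nodup_range

/-- Spanning paths that contain all pairs of distinct vertices, as many as there are vertices,
contain each pair only once. -/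
theorem isCover_of_spanning [Fintype V] [DecidableEq V] {F : Multiset (List V)}
    (hF : ∀ l ∈ F, l.Nodup) (hlen : ∀ l ∈ F, l.length = Fintype.card V)
    (hcard : F.card = Fintype.card V)
    (harcs : ∀ x y : V, x ≠ y → ∃ l ∈ F, (x, y) ∈ arcs l)
    (hheads : F.map List.head? = (Finset.univ : Finset V).val.map some)
    (hlasts : F.map List.getLast? = (Finset.univ : Finset V).val.map some) :
    IsCover (Finset.univ : Finset V) (Finset.univ : Finset V).offDiag.val F := by
  refine ⟨hF, by simp, ?_, hheads, hlasts⟩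
  symm
  apply Multiset.eq_of_le_of_card_le
  · rw [Finset.val_le_iff_val_subset]
    rintro ⟨x, y⟩ hxy
    obtain ⟨l, hl, h⟩ := harcs x y (by simpa using hxy)
    exact Multiset.mem_bind.2 ⟨l, hl, h⟩
  -- With `n` vertices, `n` lists with `n - 1` arcs each leave no room for a repeated arc.
  · rw [Multiset.card_bind, Multiset.map_congr rfl (g := fun _ => Fintype.card V - 1)]
    · simp [hcard, Finset.offDiag_card, Nat.mul_sub]
    · intro l hl
      simp [hlen l hl]

/-- If the pairs of distinct elements of a set of size `N + 1` lie on `N` cyclic orders `cyc c`, and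
one pair can be taken from each of these so that the `N` pairs form a path `z`, then the cyclic
orders, cut at these pairs, and `z` form a cover. -/
theorem hasCover_of_transversal {I : Type*} [Fintype V] [DecidableEq V] [Fintype I] {N : ℕ}
    (hV : Fintype.card V = N + 1) (hI : Fintype.card I = N) (cyc : I → ℕ → V)
    (hcyc : ∀ c, Set.InjOn (cyc c) (Set.Iio (N + 1)))
    (hpairs : ∀ x y : V, x ≠ y → ∃ c, ∃ s < N + 1, cyc c s = x ∧ cyc c ((s + 1) % (N + 1)) = y)
    (z : ℕ → V) (hz : Set.InjOn z (Set.Iio (N + 1))) (col : ℕ → I)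
    (hcol : Set.InjOn col (Set.Iio N))
    (hzcol : ∀ j < N, ∃ s < N + 1, cyc (col j) s = z j ∧
      cyc (col j) ((s + 1) % (N + 1)) = z (j + 1)) :
    HasCover (Finset.univ : Finset V) (Finset.univ : Finset V).offDiag.val := by
  classical
  choose! t ht ht₁ ht₂ using hzcol
  -- The cycle `col j` without its arc from `z j` to `z (j + 1)`, hence read from `z (j + 1)` round
  -- to `z j`. The first vertices are thus `z 0` from `z` and `z (j + 1)` from `p j`; the last ones
  -- are `z j` from `p j` and `z N` from `z`.
  let p : ℕ → List V := fun j =>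
    (List.range (N + 1)).map fun i => cyc (col j) ((t j + 1 + i) % (N + 1))
  have univ_eq : (Finset.univ : Finset V).val = ((List.range (N + 1)).map z : List V) := by
    symm
    apply Multiset.eq_of_le_of_card_le
    · exact (Multiset.le_iff_subset (Multiset.coe_nodup.2 (map_range_nodup hz))).2
        fun x _ => Finset.mem_univ x
    · simp [hV]
  refine ⟨(List.range (N + 1)).map z ::ₘ ((List.range N).map p : List (List V)),
    isCover_of_spanning ?_ ?_ ?_ ?_ ?_ ?_⟩
  · intro l hl
    simp only [Multiset.mem_cons, Multiset.mem_coe, List.mem_map, List.mem_range] at hl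
    rcases hl with rfl | ⟨j, hj, rfl⟩
    · exact map_range_nodup hz
    · refine map_range_nodup fun a ha b hb hab => ?_
      have h := hcyc (col j) (Nat.mod_lt _ N.succ_pos) (Nat.mod_lt _ N.succ_pos) hab
      have h' : a ≡ b [MOD N + 1] := Nat.ModEq.add_left_cancel' (t j + 1) h
      exact Nat.ModEq.eq_of_lt_of_lt h' ha hb
  · intro l hl
    simp only [Multiset.mem_cons, Multiset.mem_coe, List.mem_map, List.mem_range] at hl
    rcases hl with rfl | ⟨j, hj, rfl⟩ <;> simp [hV, p]
  · simp [hV]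
  · intro x y hxy
    obtain ⟨c, s, hs, rfl, rfl⟩ := hpairs x y hxy
    obtain ⟨j, hj, rfl⟩ : ∃ j < N, col j = c := by
      have hsurj : (Finset.range N).image col = Finset.univ := by
        apply Finset.eq_univ_of_card
        rw [Finset.card_image_of_injOn (by simpa using hcol), Finset.card_range, hI]
      have := Finset.mem_univ c
      rw [← hsurj] at this
      simpa using this
    -- The arc at position `t j` was taken out of its cycle and lies on `z`; every other arc of the
    -- cycle survives in `p j`.
    by_cases hst : s = t j
    · refine ⟨_, Multiset.mem_cons_self _ _, ?_⟩
      rw [hst, ht₁ j hj, ht₂ j hj]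
      exact mem_arcs_map_range z (by omega)
    · refine ⟨p j, Multiset.mem_cons_of_mem ?_, ?_⟩
      · simpa using ⟨j, hj, rfl⟩
      · have htj := ht j hj
        obtain ⟨i, hi, hi'⟩ : ∃ i < N, s = (t j + 1 + i) % (N + 1) := by
          rcases lt_or_gt_of_ne hst with h | h
          · refine ⟨s + N - t j, by omega, ?_⟩
            rw [show t j + 1 + (s + N - t j) = s + (N + 1) by omega, Nat.add_mod_right,
              Nat.mod_eq_of_lt hs]
          · refine ⟨s - t j - 1, by omega, ?_⟩
            rw [show t j + 1 + (s - t j - 1) = s by omega, Nat.mod_eq_of_lt hs]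
        have := mem_arcs_map_range (fun i => cyc (col j) ((t j + 1 + i) % (N + 1)))
          (n := N + 1) (j := i) (by omega)
        rwa [← add_assoc, Nat.add_mod (t j + 1 + i) 1, ← hi', ← Nat.add_mod_mod, Nat.mod_mod,
          Nat.add_mod_mod] at this
  · rw [univ_eq, Multiset.map_cons, Multiset.map_coe, Multiset.map_coe, List.map_map, List.map_map,
      List.range_succ_eq_map, Multiset.cons_coe]
    congr 1
    simp only [List.map_cons, List.head?_cons, List.map_map, Function.comp_apply, List.cons.injEq,
      true_and]
    refine List.map_congr_left fun j hj => ?_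
    simp [p, List.range_succ_eq_map, ht₂ j (List.mem_range.1 hj)]
  · rw [univ_eq, Multiset.map_cons, Multiset.map_coe, Multiset.map_coe, List.map_map, List.map_map,
      List.range_succ, Multiset.cons_coe, Multiset.coe_eq_coe]
    simp only [List.map_append, List.map_cons, List.map_nil, List.getLast?_concat]
    refine (List.Perm.of_eq ?_).trans (List.perm_append_singleton _ _).symm
    simp only [Function.comp_apply, List.cons.injEq, true_and]
    refine List.map_congr_left fun j hj => ?_
    rw [List.mem_range] at hj
    simp only [p, List.range_succ, List.map_append, List.map_cons, List.map_nil,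
      List.getLast?_concat, Function.comp_apply]
    rw [show t j + 1 + N = t j + (N + 1) by omega, Nat.add_mod_right, Nat.mod_eq_of_lt (ht j hj),
      ht₁ j hj]

/-! ### Even order: translates of the zigzag -/

/-- The sequence `0, 1, -1, 2, -2, …`. -/
def zigzag (n : ℕ) (j : ℕ) : ZMod n := if Even j then -((j / 2 : ℕ) : ZMod n) else ((j + 1) / 2 : ℕ)

lemma zigzag_two_mul (n j : ℕ) : zigzag n (2 * j) = -(j : ZMod n) := by
  simp [zigzag]

lemma zigzag_two_mul_add_one (n j : ℕ) : zigzag n (2 * j + 1) = (j : ZMod n) + 1 := by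
  simp [zigzag, show (2 * j + 1 + 1) / 2 = j + 1 by omega]

lemma zigzag_injOn (k : ℕ) : Set.InjOn (zigzag (2 * k)) (Set.Iio (2 * k)) := by
  have cast_inj : ∀ a b : ℕ, a < 2 * k → b < 2 * k → (a : ZMod (2 * k)) = b → a = b := by
    intro a b ha hb h
    exact Nat.ModEq.eq_of_lt_of_lt ((ZMod.natCast_eq_natCast_iff _ _ _).1 h) ha hb
  have ne : ∀ a b : ℕ, a < k → b < k → -(a : ZMod (2 * k)) ≠ (b : ZMod (2 * k)) + 1 := by
    intro a b ha hb h
    have h' : ((a + b + 1 : ℕ) : ZMod (2 * k)) = (0 : ℕ) := by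
      push_cast
      linear_combination -h
    have := cast_inj _ _ (by omega) (by omega) h'
    omega
  intro i hi j hj h
  rw [Set.mem_Iio] at hi hj
  rcases Nat.even_or_odd' i with ⟨a, rfl | rfl⟩ <;> rcases Nat.even_or_odd' j with ⟨b, rfl | rfl⟩ <;>
    simp only [zigzag_two_mul, zigzag_two_mul_add_one] at h
  · rw [cast_inj a b (by omega) (by omega) (neg_injective h)]
  · exact absurd h (ne a b (by omega) (by omega))
  · exact absurd h.symm (ne b a (by omega) (by omega))
  · rw [cast_inj a b (by omega) (by omega) (add_right_cancel h)]

/-- The consecutive differences are `1, -2, 3, -4, …`. Odd residues `2 * t + 1` occur at position `2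
* t`; an even residue `2 * t` is `-(2 * k - 2 * t)`, found at position `2 * (k - t - 1) + 1`. -/
lemma exists_zigzag_sub (k : ℕ) [NeZero (2 * k)] {d : ZMod (2 * k)} (hd : d ≠ 0) :
    ∃ j, j + 1 < 2 * k ∧ zigzag (2 * k) (j + 1) - zigzag (2 * k) j = d := by
  have hlt := ZMod.val_lt d
  have hpos : d.val ≠ 0 := by simpa using hd
  have hval : ((d.val : ℕ) : ZMod (2 * k)) = d := ZMod.natCast_zmod_val d
  rcases Nat.even_or_odd' d.val with ⟨t, ht | ht⟩
  · obtain ⟨s, rfl⟩ : ∃ s, k = s + t + 1 := ⟨k - t - 1, by omega⟩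
    refine ⟨2 * s + 1, by omega, ?_⟩
    rw [show 2 * s + 1 + 1 = 2 * (s + 1) by ring, zigzag_two_mul, zigzag_two_mul_add_one, ← hval, ht]
    have := ZMod.natCast_self (2 * (s + t + 1))
    push_cast at this ⊢
    linear_combination -this
  · refine ⟨2 * t, by omega, ?_⟩
    rw [zigzag_two_mul, zigzag_two_mul_add_one, ← hval, ht]
    push_cast
    ring

/-- The complete graph on an even number of vertices. -/
theorem hasCover_zmod (k : ℕ) [NeZero (2 * k)] :
    HasCover (Finset.univ : Finset (ZMod (2 * k)))
      (Finset.univ : Finset (ZMod (2 * k))).offDiag.val := by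
  obtain ⟨n, hn⟩ : ∃ n, 2 * k = n + 1 := Nat.exists_eq_succ_of_ne_zero (NeZero.ne _)
  -- The difference `y - x` fixes a position in the zigzag, and `x` then fixes the translate
  -- containing the arc. First entries run through the whole group, and so do last entries.
  let p : ZMod (2 * k) → List (ZMod (2 * k)) := fun c =>
    (List.range (2 * k)).map fun j => zigzag (2 * k) j + c
  have map_add : ∀ a : ZMod (2 * k), (Finset.univ.val.map fun c => some (a + c)) =
      (Finset.univ : Finset (ZMod (2 * k))).val.map some := by
    intro a
    conv_rhs => rw [← Multiset.map_univ_val_equiv (Equiv.addLeft a), Multiset.map_map]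
    rfl
  refine ⟨Finset.univ.val.map p, isCover_of_spanning ?_ ?_ ?_ ?_ ?_ ?_⟩
  · intro l hl
    obtain ⟨c, -, rfl⟩ := Multiset.mem_map.1 hl
    exact map_range_nodup fun i hi j hj h => zigzag_injOn k hi hj (add_right_cancel h)
  · intro l hl
    obtain ⟨c, -, rfl⟩ := Multiset.mem_map.1 hl
    simp [p]
  · simp
  · intro x y hxy
    obtain ⟨j, hj, h⟩ := exists_zigzag_sub k (sub_ne_zero.2 hxy.symm)
    refine ⟨p (x - zigzag (2 * k) j), Multiset.mem_map_of_mem _ (by simp), ?_⟩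
    have := mem_arcs_map_range (fun i => zigzag (2 * k) i + (x - zigzag (2 * k) j)) hj
    convert this using 2
    · ring
    · linear_combination -h
  · rw [← map_add (zigzag (2 * k) 0), Multiset.map_map]
    refine Multiset.map_congr rfl fun c _ => ?_
    simp [p, hn, List.range_succ_eq_map]
  · rw [← map_add (zigzag (2 * k) n), Multiset.map_map]
    refine Multiset.map_congr rfl fun c _ => ?_
    simp [p, hn, List.range_succ]

/-! ### Odd order: zigzag cycles through a point at infinity -/

/-- The cyclic order `∞, c, c + 1, c - 1, c + 2, …, c + k` on `ZMod (2 * k)` with a point `∞ = none`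
added. -/
def zigzagCycle (k : ℕ) (c : ZMod (2 * k)) : ℕ → Option (ZMod (2 * k))
  | 0 => none
  | j + 1 => some (zigzag (2 * k) j + c)

lemma zigzagCycle_injOn (k : ℕ) (c : ZMod (2 * k)) :
    Set.InjOn (zigzagCycle k c) (Set.Iio (2 * k + 1)) := by
  intro i hi j hj h
  rw [Set.mem_Iio] at hi hj
  cases i <;> cases j
  · rfl
  · simp [zigzagCycle] at h
  · simp [zigzagCycle] at h
  · rw [zigzag_injOn k (Set.mem_Iio.2 (by omega)) (Set.mem_Iio.2 (by omega))
      (add_right_cancel (Option.some_injective _ h))]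

/-- `y` comes right after `x` in the cyclic order `zigzagCycle k c`. -/
def ZigzagNext (k : ℕ) (c : ZMod (2 * k)) (x y : Option (ZMod (2 * k))) : Prop :=
  ∃ s < 2 * k + 1, zigzagCycle k c s = x ∧ zigzagCycle k c ((s + 1) % (2 * k + 1)) = y

lemma zigzagNext_some {k : ℕ} {c x y : ZMod (2 * k)} {j : ℕ} (hj : j + 1 < 2 * k)
    (hx : zigzag (2 * k) j + c = x) (hy : zigzag (2 * k) (j + 1) + c = y) :
    ZigzagNext k c (some x) (some y) := by
  refine ⟨j + 1, by omega, congrArg some hx, ?_⟩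
  rw [Nat.mod_eq_of_lt (by omega)]
  exact congrArg some hy

lemma zigzagNext_none_some {k : ℕ} (hk : 0 < k) (c : ZMod (2 * k)) :
    ZigzagNext k c none (some c) := by
  refine ⟨0, by omega, rfl, ?_⟩
  rw [Nat.mod_eq_of_lt (by omega)]
  simp [zigzagCycle, zigzag]

lemma zigzagNext_some_none {k : ℕ} (hk : 0 < k) {c x : ZMod (2 * k)} (hx : x = c + k) :
    ZigzagNext k c (some x) none := by
  obtain ⟨m, rfl⟩ := Nat.exists_eq_succ_of_ne_zero hk.ne'
  refine ⟨2 * m + 1 + 1, by omega, ?_, ?_⟩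
  · rw [zigzagCycle, zigzag_two_mul_add_one, hx]
    push_cast
    ring_nf
  · rw [show 2 * m + 1 + 1 + 1 = 2 * m.succ + 1 by omega, Nat.mod_self, zigzagCycle]

lemma exists_zigzagNext (k : ℕ) [NeZero (2 * k)] {x y : Option (ZMod (2 * k))} (hxy : x ≠ y) :
    ∃ c, ZigzagNext k c x y := by
  have hk : 0 < k := by have := NeZero.ne (2 * k); omega
  rcases x with _ | x <;> rcases y with _ | y
  · exact absurd rfl hxy
  · exact ⟨y, zigzagNext_none_some hk y⟩
  · exact ⟨x - k, zigzagNext_some_none hk (by ring)⟩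
  · obtain ⟨j, hj, h⟩ := exists_zigzag_sub k (d := y - x)
      (sub_ne_zero.2 fun h => hxy (congrArg some h.symm))
    exact ⟨x - zigzag (2 * k) j, zigzagNext_some hj (by ring) (by linear_combination h)⟩

/-- Elements of `Option (ZMod n)` written as numbers up to `n`. -/
def ofNat (n m : ℕ) : Option (ZMod n) := if m = n then none else some m

lemma ofNat_injOn (n : ℕ) : Set.InjOn (ofNat n) (Set.Iio (n + 1)) := by
  intro i hi j hj h
  rw [Set.mem_Iio] at hi hj
  simp only [ofNat] at h
  split_ifs at h with h₁ h₂ h₂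
  · omega
  · exact Nat.ModEq.eq_of_lt_of_lt ((ZMod.natCast_eq_natCast_iff _ _ _).1 (Option.some_injective _ h))
      (by omega) (by omega)

/-- These are the arcs used by the transversals, with residues spelled out as natural numbers below
`2 * k` and infinity as `2 * k`. Differences `-2`, `-4` and `-1` sit at zigzag positions 1, 3 and `2
* k - 2`, so they belong to the cycles `x - 1`, `x - 2` and `x + k - 1`; the arcs at infinity belong
to the cycles `y` and `x + k`. -/
lemma zigzagNext_ofNat {k x y c : ℕ} (hk : 3 ≤ k)
    (h : x < 2 * k ∧ y < 2 * k ∧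
        (x = y + 2 ∧ c + 1 = x ∨ x + 2 * k = y + 4 ∧ c + 2 = x ∨
          (x = y + 1 ∨ x + 2 * k = y + 1) ∧ (c + 1 = x + k ∨ c + 1 + 2 * k = x + k)) ∨
      x = 2 * k ∧ y < 2 * k ∧ c = y ∨
      y = 2 * k ∧ x < 2 * k ∧ (c = x + k ∨ c + 2 * k = x + k)) :
    ZigzagNext k c (ofNat (2 * k) x) (ofNat (2 * k) y) := by
  have h2k : (2 * k : ZMod (2 * k)) = 0 := by exact_mod_cast ZMod.natCast_self (2 * k)
  have cast : ∀ a b : ℕ, a = b → (a : ZMod (2 * k)) = b := fun a b h => by rw [h]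
  rcases h with ⟨hx, hy, h⟩ | ⟨rfl, hy, rfl⟩ | ⟨rfl, hx, h⟩
  · simp only [ofNat, hx.ne, hy.ne, if_false]
    rcases h with ⟨h, h'⟩ | ⟨h, h'⟩ | ⟨h, h'⟩
    · have h := cast _ _ h
      have h' := cast _ _ h'
      push_cast at h h'
      refine zigzagNext_some (j := 2 * 0 + 1) (by omega) ?_ ?_
      · rw [zigzag_two_mul_add_one]
        push_cast
        linear_combination h'
      · rw [show 2 * 0 + 1 + 1 = 2 * 1 by rfl, zigzag_two_mul]
        push_cast
        linear_combination h' + h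
    · have h := cast _ _ h
      have h' := cast _ _ h'
      push_cast at h h'
      refine zigzagNext_some (j := 2 * 1 + 1) (by omega) ?_ ?_
      · rw [zigzag_two_mul_add_one]
        push_cast
        linear_combination h'
      · rw [show 2 * 1 + 1 + 1 = 2 * 2 by rfl, zigzag_two_mul]
        push_cast
        linear_combination h' + h - h2k
    · have h : (x : ZMod (2 * k)) = y + 1 := by
        rcases h with h | h <;> have h := cast _ _ h <;> push_cast at h
        · exact h
        · linear_combination h - h2k
      have h' : (c : ZMod (2 * k)) + 1 = x + k := by
        rcases h' with h' | h' <;> have h' := cast _ _ h' <;> push_cast at h'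
        · exact h'
        · linear_combination h' - h2k
      obtain ⟨m, rfl⟩ : ∃ m, k = m + 1 := ⟨k - 1, by omega⟩
      refine zigzagNext_some (j := 2 * m) (by omega) ?_ ?_
      · rw [zigzag_two_mul]
        push_cast at *
        linear_combination h'
      · rw [zigzag_two_mul_add_one]
        push_cast at *
        linear_combination h' + h + h2k
  · simpa [ofNat, hy.ne] using zigzagNext_none_some (by omega) _
  · simp only [ofNat, hx.ne, if_false, if_true]
    refine zigzagNext_some_none (by omega) ?_
    rcases h with h | h <;> have h := cast _ _ h <;> push_cast at h
    · linear_combination -h - h2k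
    · linear_combination -h

/-- The search for a transversal becomes linear arithmetic over the natural numbers, within reach of
`omega`. -/
lemma hasCover_of_zigzag_transversal {k : ℕ} (hk : 3 ≤ k) [NeZero (2 * k)] (z col : ℕ → ℕ)
    (hz : Set.MapsTo z (Set.Iio (2 * k + 1)) (Set.Iio (2 * k + 1)))
    (hz' : Set.InjOn z (Set.Iio (2 * k + 1)))
    (hcol : Set.MapsTo col (Set.Iio (2 * k)) (Set.Iio (2 * k)))
    (hcol' : Set.InjOn col (Set.Iio (2 * k)))
    (h : ∀ j < 2 * k, z j < 2 * k ∧ z (j + 1) < 2 * k ∧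
        (z j = z (j + 1) + 2 ∧ col j + 1 = z j ∨
          z j + 2 * k = z (j + 1) + 4 ∧ col j + 2 = z j ∨
          (z j = z (j + 1) + 1 ∨ z j + 2 * k = z (j + 1) + 1) ∧
            (col j + 1 = z j + k ∨ col j + 1 + 2 * k = z j + k)) ∨
      z j = 2 * k ∧ z (j + 1) < 2 * k ∧ col j = z (j + 1) ∨
      z (j + 1) = 2 * k ∧ z j < 2 * k ∧ (col j = z j + k ∨ col j + 2 * k = z j + k)) :
    HasCover (Finset.univ : Finset (Option (ZMod (2 * k))))
      (Finset.univ : Finset (Option (ZMod (2 * k)))).offDiag.val := by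
  refine hasCover_of_transversal (N := 2 * k) (by simp [ZMod.card]) (ZMod.card _) (zigzagCycle k)
    (zigzagCycle_injOn k) (fun x y hxy => exists_zigzagNext k hxy) (fun j => ofNat (2 * k) (z j))
    ((ofNat_injOn (2 * k)).comp hz' hz) (fun j => (col j : ZMod (2 * k))) ?_
    (fun j hj => zigzagNext_ofNat hk (h j hj))
  intro i hi j hj hij
  exact hcol' hi hj (Nat.ModEq.eq_of_lt_of_lt ((ZMod.natCast_eq_natCast_iff _ _ _).1 hij)
    (hcol hi) (hcol hj))

/-- The path `k - 1, k - 3, …, 2, 2k - 2, 2k - 4, …, k + 1, ∞, 2k - 1, 2k - 3, …, 1, 0`. -/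
lemma hasCover_option_zmod_of_odd {k : ℕ} (hk : 3 ≤ k) [NeZero (2 * k)] (hodd : Odd k) :
    HasCover (Finset.univ : Finset (Option (ZMod (2 * k))))
      (Finset.univ : Finset (Option (ZMod (2 * k)))).offDiag.val := by
  obtain ⟨h, hh⟩ := hodd
  refine hasCover_of_zigzag_transversal hk
    (fun j => if j < h then 2 * h - 2 * j else if j < 2 * h then 6 * h - 2 * j else
      if j = 2 * h then 4 * h + 2 else if j < 4 * h + 2 then 8 * h + 3 - 2 * j else 0)
    -- The cycle of each arc as forced by its difference: mostly `-2`, with `-4` from `2` to `2 * k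
    -- - 2`, `-1` from `1` to `0`, and two arcs at infinity.
    (fun j => if j + 1 < h then 2 * h - 2 * j - 1 else if j + 1 = h then 0 else
      if j + 1 < 2 * h then 6 * h - 2 * j - 1 else if j + 1 = 2 * h then 1 else
      if j = 2 * h then 4 * h + 1 else if j < 4 * h + 1 then 8 * h + 2 - 2 * j else 2 * h + 1)
    ?_ ?_ ?_ ?_ ?_
  · intro i hi
    simp only [Set.mem_Iio] at *
    split_ifs <;> omega
  · intro i hi j hj hij
    simp only [Set.mem_Iio] at *
    split_ifs at hij <;> omega
  · intro i hi
    simp only [Set.mem_Iio] at *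
    split_ifs <;> omega
  · intro i hi j hj hij
    simp only [Set.mem_Iio] at *
    split_ifs at hij <;> omega
  · intro j hj
    have : j + 1 < h ∨ j + 1 = h ∨ h < j + 1 ∧ j + 1 < 2 * h ∨ h < j + 1 ∧ j + 1 = 2 * h ∨
      j = 2 * h ∨ 2 * h < j ∧ j < 4 * h + 1 ∨ j = 4 * h + 1 := by omega
    rcases this with hj | hj | hj | hj | hj | hj | hj <;>
      simp (disch := omega) only [if_pos, if_neg] <;> omega

set_option maxHeartbeats 1000000 in
/-- The path `k - 2, k - 4, …, 2, 2k - 2, 2k - 4, …, k, k - 1, k - 3, …, 1, 0, 2k - 1, 2k - 3, …,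
k + 1, ∞`. -/
lemma hasCover_option_zmod_of_even {k : ℕ} (hk : 3 ≤ k) [NeZero (2 * k)] (heven : Even k) :
    HasCover (Finset.univ : Finset (Option (ZMod (2 * k))))
      (Finset.univ : Finset (Option (ZMod (2 * k)))).offDiag.val := by
  obtain ⟨h, hh⟩ := heven
  refine hasCover_of_zigzag_transversal hk
    (fun j => if j + 1 < h then 2 * h - 2 - 2 * j else if j + 1 < 2 * h then 6 * h - 4 - 2 * j else
      if j + 1 < 3 * h then 6 * h - 3 - 2 * j else if j + 1 = 3 * h then 0 else
      if j < 4 * h then 10 * h - 1 - 2 * j else 4 * h)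
    -- Besides differences `-2`, there is `-4` from `2` to `2 * k - 2`, `-1` from `k` to `k - 1`,
    -- from `1` to `0` and from `0` to `2 * k - 1`, and the final arc to infinity.
    (fun j => if j + 2 < h then 2 * h - 3 - 2 * j else if j + 2 = h then 0 else
      if j + 2 < 2 * h then 6 * h - 5 - 2 * j else if j + 2 = 2 * h then 4 * h - 1 else
      if j + 2 < 3 * h then 6 * h - 4 - 2 * j else if j + 2 = 3 * h then 2 * h else
      if j + 1 = 3 * h then 2 * h - 1 else if j + 1 < 4 * h then 10 * h - 2 - 2 * j else 1)
    ?_ ?_ ?_ ?_ ?_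
  · intro i hi
    simp only [Set.mem_Iio] at *
    split_ifs <;> omega
  · intro i hi j hj hij
    rw [Set.mem_Iio] at hi hj
    beta_reduce at hij
    split_ifs at hij <;> omega
  · intro i hi
    simp only [Set.mem_Iio] at *
    split_ifs <;> omega
  · intro i hi j hj hij
    rw [Set.mem_Iio] at hi hj
    beta_reduce at hij
    split_ifs at hij <;> omega
  · intro j hj
    have : j + 2 < h ∨ j + 2 = h ∨ h < j + 2 ∧ j + 2 < 2 * h ∨ j + 2 = 2 * h ∨
      2 * h < j + 2 ∧ j + 2 < 3 * h ∨ j + 2 = 3 * h ∨ j + 1 = 3 * h ∨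
      3 * h < j + 1 ∧ j + 1 < 4 * h ∨ j + 1 = 4 * h := by omega
    rcases this with hj | hj | hj | hj | hj | hj | hj | hj | hj <;>
      simp (disch := omega) only [if_pos, if_neg] <;> omega

lemma HasCover.of_card_eq [Fintype W] [DecidableEq W] [DecidableEq V] {S : Finset V}
    (h : HasCover (Finset.univ : Finset W) (Finset.univ : Finset W).offDiag.val)
    (hS : S.card = Fintype.card W) : HasCover S S.offDiag.val := by
  let e : W ≃ S := Fintype.equivOfCardEq (by simp [hS])
  let f : W ↪ V := e.toEmbedding.trans (Function.Embedding.subtype _)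
  have hf : Finset.univ.map f = S := by
    rw [← Finset.map_map, Finset.map_univ_equiv]
    ext
    simp
  have := h.map f
  rwa [offDiag_map, hf] at this

/-- The directed complete graph on `n ≠ 3, 5` vertices decomposes into `n` spanning paths, one from
and one to each vertex. -/
theorem hasCover_offDiag [DecidableEq V] {S : Finset V} (hS : S.Nonempty) (h₃ : S.card ≠ 3)
    (h₅ : S.card ≠ 5) : HasCover S S.offDiag.val := by
  have hpos := hS.card_pos
  rcases Nat.even_or_odd' S.card with ⟨k, hk | hk⟩
  · have : NeZero (2 * k) := ⟨by omega⟩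
    exact (hasCover_zmod k).of_card_eq (by rw [hk, ZMod.card])
  · rcases Nat.eq_zero_or_pos k with rfl | hk0
    · obtain ⟨v, rfl⟩ := Finset.card_eq_one.1 hk
      exact ⟨{[v]}, by simp, by simp, by simp, by simp, by simp⟩
    · have : NeZero (2 * k) := ⟨by omega⟩
      -- Orders 1, 3 and 5 being excluded, the odd order is at least 7.
      have hk3 : 3 ≤ k := by omega
      have h : HasCover (Finset.univ : Finset (Option (ZMod (2 * k))))
          (Finset.univ : Finset (Option (ZMod (2 * k)))).offDiag.val :=
        (Nat.even_or_odd k).elim (hasCover_option_zmod_of_even hk3)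
          (hasCover_option_zmod_of_odd hk3)
      exact h.of_card_eq (by simp [hk, ZMod.card])

end PathCover

/-! ### Cut-open families for the cliques of order 3 and 5 -/

namespace PathCover

variable {V : Type*}

/-- An incoming and an outgoing piece of the same index may share vertices besides `0`, as `[2, 1,
0]` and `[0, 2]` do: they are continued outside the clique, not by each other. -/
lemma hasPieceCover_fin_three :
    HasPieceCover (0 : Fin 3) Finset.univ Finset.univ.val Finset.univ.offDiag.val 1 ∧
    HasPieceCover (0 : Fin 3) Finset.univ Finset.univ.val Finset.univ.offDiag.val 2 ∧
    HasPieceCover (0 : Fin 3) Finset.univ (Finset.univ.erase 0).val Finset.univ.offDiag.val 2 := by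
  refine ⟨⟨![[2, 1, 0]], ![[0, 2]], {[0, 1], [1, 2, 0]}, ?_⟩,
    ⟨![[2, 1, 0], [0]], ![[0, 2], [0, 1]], {[1, 2, 0]}, ?_⟩,
    ⟨![[2, 1, 0], [1, 2, 0]], ![[0, 2], [0, 1]], 0, ?_⟩⟩ <;>
  constructor <;> decide

set_option maxRecDepth 10000 in
lemma hasPieceCover_fin_five :
    HasPieceCover (0 : Fin 5) Finset.univ Finset.univ.val Finset.univ.offDiag.val 1 ∧
    HasPieceCover (0 : Fin 5) Finset.univ Finset.univ.val Finset.univ.offDiag.val 2 ∧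
    HasPieceCover (0 : Fin 5) Finset.univ (Finset.univ.erase 0).val Finset.univ.offDiag.val 2 := by
  refine ⟨⟨![[2, 3, 1, 4, 0]], ![[0, 3]],
      {[0, 4, 1, 2], [1, 3, 0, 2, 4], [3, 4, 2, 0, 1], [4, 3, 2, 1, 0]}, ?_⟩,
    ⟨![[4, 0], [3, 2, 0]], ![[0, 3, 1, 2, 4], [0, 2, 1, 4, 3]],
      {[0, 1, 3, 4, 2], [1, 0], [2, 3, 0, 4, 1]}, ?_⟩,
    ⟨![[4, 0], [1, 2, 3, 0]], ![[0, 2, 1, 4, 3], [0, 1, 3, 2, 4]],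
      {[2, 0, 3, 4, 1], [3, 1, 0, 4, 2]}, ?_⟩⟩ <;>
  constructor <;> decide

lemma exists_embedding_of_card_eq [DecidableEq V] {S : Finset V} {v : V} (hv : v ∈ S) {n : ℕ}
    (hS : S.card = n + 1) : ∃ f : Fin (n + 1) ↪ V, f 0 = v ∧ Finset.univ.map f = S := by
  let e : Fin (n + 1) ≃ S := (Fintype.equivOfCardEq (by simp [hS]))
  let e' : Fin (n + 1) ≃ S := e.trans (Equiv.swap (e 0) ⟨v, hv⟩)
  refine ⟨e'.toEmbedding.trans (Function.Embedding.subtype _), ?_, ?_⟩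
  · simp [e']
  · rw [← Finset.map_map, Finset.map_univ_equiv]
    ext
    simp

/-- Piece covers of the complete graphs with three and five vertices. -/
theorem hasPieceCover_offDiag [DecidableEq V] {S : Finset V} {v : V} (hv : v ∈ S)
    (hS : S.card = 3 ∨ S.card = 5) :
    HasPieceCover v S S.val S.offDiag.val 1 ∧ HasPieceCover v S S.val S.offDiag.val 2 ∧
    HasPieceCover v S (S.erase v).val S.offDiag.val 2 := by
  have key : ∀ n : ℕ, S.card = n + 1 →
      HasPieceCover (0 : Fin (n + 1)) Finset.univ Finset.univ.val Finset.univ.offDiag.val 1 ∧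
      HasPieceCover (0 : Fin (n + 1)) Finset.univ Finset.univ.val Finset.univ.offDiag.val 2 ∧
      HasPieceCover (0 : Fin (n + 1)) Finset.univ (Finset.univ.erase 0).val
        Finset.univ.offDiag.val 2 →
      HasPieceCover v S S.val S.offDiag.val 1 ∧ HasPieceCover v S S.val S.offDiag.val 2 ∧
      HasPieceCover v S (S.erase v).val S.offDiag.val 2 := by
    rintro n hn ⟨h₁, h₂, h₃⟩
    obtain ⟨f, rfl, rfl⟩ := exists_embedding_of_card_eq hv hn
    rw [← Finset.map_erase, ← offDiag_map]
    exact ⟨h₁.map f, h₂.map f, h₃.map f⟩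
  exact hS.elim (fun h => key 2 h hasPieceCover_fin_three)
    (fun h => key 4 h hasPieceCover_fin_five)

end PathCover

/-! ### Connected block graphs: induction over cut vertices -/

namespace PathCover

open SimpleGraph

variable {V : Type*} (G : SimpleGraph V)

/-- `S` is not empty and induces a connected subgraph: every nonempty proper part of `S` is joined
to the rest of `S`. -/
def IsConn (S : Finset V) : Prop :=
  S.Nonempty ∧ ∀ A ⊆ S, A.Nonempty → (∀ a ∈ A, ∀ b ∈ S, b ∉ A → ¬ G.Adj a b) → A = S

/-- The pairs of adjacent vertices in `S`. -/
noncomputable def adjPairs (S : Finset V) : Finset (V × V) := by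
  classical exact (S ×ˢ S).filter fun e => G.Adj e.1 e.2

variable {G}

lemma mem_adjPairs {S : Finset V} {e : V × V} :
    e ∈ adjPairs G S ↔ (e.1 ∈ S ∧ e.2 ∈ S) ∧ G.Adj e.1 e.2 := by
  simp [adjPairs]

/-- A graph `G'` on a set `S` of vertices of `G` containing all edges of `G` in `S` is connected if
`S` induces a connected subgraph. -/
lemma IsConn.preconnected {W : Type*} {S : Finset V} (h : IsConn G S) {G' : SimpleGraph W}
    (f : W → V) (hf : Function.Injective f) (hS : ∀ x, x ∈ S ↔ ∃ w, f w = x)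
    (hadj : ∀ x y, G.Adj (f x) (f y) → G'.Adj x y) : G'.Preconnected := by
  classical
  intro a b
  -- No edge leaves the set of vertices reachable from `a`, so it is all of `S`.
  have hA := h.2 (S.filter fun x => ∃ w, f w = x ∧ G'.Reachable a w) (Finset.filter_subset _ _)
    ⟨f a, by simpa [hS] using ⟨a, rfl, .rfl⟩⟩ ?_
  · have hb : f b ∈ S := (hS _).2 ⟨b, rfl⟩
    rw [← hA, Finset.mem_filter] at hb
    obtain ⟨-, w, hw, hr⟩ := hb
    rwa [hf hw] at hr
  · intro x hx y hy hxy hadj'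
    obtain ⟨-, w, rfl, hw⟩ := Finset.mem_filter.1 hx
    obtain ⟨u, rfl⟩ := (hS y).1 hy
    exact hxy (Finset.mem_filter.2 ⟨hy, u, rfl, hw.trans (hadj _ _ hadj').reachable⟩)

lemma adjPairs_of_isClique {S : Finset V} (h : G.IsClique S) : adjPairs G S = S.offDiag := by
  ext ⟨x, y⟩
  rw [mem_adjPairs, Finset.mem_offDiag]
  constructor
  · rintro ⟨⟨hx, hy⟩, hxy⟩
    exact ⟨hx, hy, hxy.ne⟩
  · rintro ⟨hx, hy, hxy⟩
    exact ⟨⟨hx, hy⟩, h hx hy hxy⟩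

lemma IsConn.exists_adj {S : Finset V} (hS : IsConn G S) {v : V} (hv : v ∈ S) (h1 : S ≠ {v}) :
    ∃ w, (v, w) ∈ (adjPairs G S).val := by
  by_contra! hcon
  refine h1 (hS.2 {v} (by simpa using hv) (by simp) fun a ha b hb _ hab => ?_).symm
  rw [Finset.mem_singleton] at ha
  subst ha
  exact hcon b (mem_adjPairs.2 ⟨⟨hv, hb⟩, hab⟩ : (a, b) ∈ adjPairs G S)

variable [DecidableEq V]

/-- No edge runs between the two differences, and an edge inside both sets would need two common
vertices. -/
lemma adjPairs_union {S T : Finset V} (hdisj : (S ∩ T).card ≤ 1)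
    (h : ∀ a ∈ S, ∀ b ∈ T, G.Adj a b → a ∈ T ∨ b ∈ S) :
    (adjPairs G (S ∪ T)).val = (adjPairs G S).val + (adjPairs G T).val := by
  have hd : Disjoint (adjPairs G S) (adjPairs G T) := by
    rw [Finset.disjoint_left]
    rintro ⟨x, y⟩ h₁ h₂
    rw [mem_adjPairs] at h₁ h₂
    exact h₁.2.ne (Finset.card_le_one.1 hdisj x (by simp_all) y (by simp_all))
  rw [← Finset.disjUnion_val _ _ hd, Finset.disjUnion_eq_union]
  congr 1
  ext ⟨x, y⟩
  simp only [Finset.mem_union, mem_adjPairs]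
  constructor
  · rintro ⟨⟨hx, hy⟩, hxy⟩
    have h₁ := h x
    have h₂ := h y
    have := hxy.symm
    grind
  · grind

/-- In a block graph, a set of vertices that induces a connected subgraph without cut vertices is a
clique. -/
lemma isClique_of_isConn [Finite V] (hG : G.IsBlockGraph) {S : Finset V} (hS : IsConn G S)
    (hcut : ∀ v ∈ S, (S.erase v).Nonempty → IsConn G (S.erase v)) : G.IsClique S := by
  let H : G.Subgraph := (⊤ : G.Subgraph).induce S
  have hH : H.coe.Connected ∧ ∀ v, ¬ H.coe.IsCutVertex v := by
    refine ⟨?_, ?_⟩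
    · obtain ⟨x, hx⟩ := hS.1
      have : Nonempty H.verts := ⟨⟨x, hx⟩⟩
      refine ⟨hS.preconnected Subtype.val Subtype.val_injective ?_ ?_⟩
      · intro x
        exact ⟨fun h => ⟨⟨x, h⟩, rfl⟩, fun ⟨w, hw⟩ => hw ▸ w.2⟩
      · intro x y hxy
        exact ⟨x.2, y.2, hxy⟩
    · rintro v ⟨a, b, -, hab⟩
      have hne : ∀ c : ({v}ᶜ : Set H.verts), (c : V) ∈ S.erase v := fun c =>
        Finset.mem_erase.2 ⟨fun h => c.2 (Subtype.ext h), c.1.2⟩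
      refine hab ((hcut v v.2 ⟨_, hne a⟩).preconnected (fun c => (c.1.1 : V))
        (Subtype.val_injective.comp Subtype.val_injective) ?_ ?_ a b)
      · intro x
        refine ⟨fun h => ?_, fun ⟨w, hw⟩ => hw ▸ hne w⟩
        rw [Finset.mem_erase] at h
        exact ⟨⟨⟨x, h.2⟩, fun h' => h.1 (congrArg Subtype.val h')⟩, rfl⟩
      · intro x y hxy
        exact ⟨x.1.2, y.1.2, hxy⟩
  -- By finiteness the induced subgraph lies in a block, whose vertices form a clique.
  obtain ⟨B, hHB, hB⟩ := Finite.exists_le_maximal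
    (p := fun H : G.Subgraph => H.coe.Connected ∧ ∀ v, ¬ H.coe.IsCutVertex v) hH
  exact (hG B hB).subset hHB.1

/-- A vertex set in a connected set that is joined to the rest by a single vertex only. -/
lemma IsConn.insert_part {S A : Finset V} {v : V} (hS : IsConn G S) (hv : v ∈ S) (hA : A ⊆ S.erase v)
    (h : ∀ a ∈ A, ∀ b ∈ S.erase v, b ∉ A → ¬ G.Adj a b) : IsConn G (insert v A) := by
  have hAS : insert v A ⊆ S :=
    Finset.insert_subset hv (hA.trans (Finset.erase_subset _ _))
  have hvA : v ∉ A := fun h => by simpa using hA h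
  -- Edges from `A` stay in `A` or go to `v`. A part of `A` with no edge leaving it in `insert v A`
  -- would have none in `S` either, hence equal `S` and contain `v`.
  have key : ∀ B ⊆ insert v A, B.Nonempty → v ∉ B →
      ¬ ∀ a ∈ B, ∀ b ∈ insert v A, b ∉ B → ¬ G.Adj a b := by
    intro B hB hne hvB hadj
    have hBA : B ⊆ A := (Finset.subset_insert_iff_of_notMem hvB).1 hB
    refine hvB ?_
    rw [hS.2 B (hB.trans hAS) hne fun a ha b hb hbB hab => ?_]
    · exact hv
    · by_cases hb' : b ∈ insert v A
      · exact hadj a ha b hb' hbB hab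
      · rw [Finset.mem_insert, not_or] at hb'
        exact h a (hBA ha) b (Finset.mem_erase.2 ⟨hb'.1, hb⟩) hb'.2 hab
  refine ⟨⟨v, Finset.mem_insert_self _ _⟩, fun B hB hne hadj => ?_⟩
  by_cases hvB : v ∈ B
  -- A part containing `v` is handled through its complement, which avoids `v`.
  · by_contra hBA
    refine key (insert v A \ B) Finset.sdiff_subset ?_ (by simp [hvB]) fun a ha b hb hbB hab => ?_
    · rw [Finset.sdiff_nonempty]
      exact fun h => hBA (hB.antisymm h)
    · rw [Finset.mem_sdiff] at ha hbB
      have hbB' : b ∈ B := by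
        by_contra h
        exact hbB ⟨hb, h⟩
      exact hadj b hbB' a ha.1 ha.2 hab.symm
  · exact absurd hadj (key B hB hne hvB)

/-- `S` induces a complete graph with three or five vertices. -/
def IsSmallOddClique (G : SimpleGraph V) (S : Finset V) : Prop :=
  G.IsClique S ∧ (S.card = 3 ∨ S.card = 5)

/-- One side must give up its ends at `v`, the other keep them, with equally many cuts. A covered
side can give them up with one cut, and the other side keeps them with one cut whether covered or
small. Two small cliques are matched with two cuts. -/
theorem hasCover_union {S T : Finset V} {v : V} (hS : IsConn G S) (hT : IsConn G T)
    (hST : S ∩ T = {v}) (hS1 : S ≠ {v}) (hT1 : T ≠ {v})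
    (h : ∀ a ∈ S, ∀ b ∈ T, G.Adj a b → a ∈ T ∨ b ∈ S)
    (hcS : HasCover S (adjPairs G S).val ∨ IsSmallOddClique G S)
    (hcT : HasCover T (adjPairs G T).val ∨ IsSmallOddClique G T) :
    HasCover (S ∪ T) (adjPairs G (S ∪ T)).val := by
  have hv : v ∈ S ∩ T := by simp [hST]
  rw [Finset.mem_inter] at hv
  obtain ⟨w, hw⟩ := hS.exists_adj hv.1 hS1
  obtain ⟨u, hu⟩ := hT.exists_adj hv.2 hT1
  have val_union : (S ∪ T).val = (S.erase v).val + T.val := by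
    have hd : Disjoint (S.erase v) T := by
      rw [Finset.disjoint_left]
      intro x hx hxT
      rw [Finset.mem_erase] at hx
      have : x ∈ S ∩ T := Finset.mem_inter.2 ⟨hx.2, hxT⟩
      rw [hST, Finset.mem_singleton] at this
      exact hx.1 this
    rw [← Finset.disjUnion_val _ _ hd, Finset.disjUnion_eq_union, ← Finset.erase_union_of_mem hv.2]
  have val_union' : (S ∪ T).val = S.val + (T.erase v).val := by
    rw [val_union, Finset.erase_val, Finset.erase_val, ← Multiset.cons_erase (s := S.val) hv.1,
      Multiset.erase_cons_head]
    conv_lhs => rw [← Multiset.cons_erase (s := T.val) hv.2]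
    rw [Multiset.add_cons, Multiset.cons_add]
  rw [adjPairs_union (by simp [hST]) h]
  rcases hcS with hcS | ⟨hS₁, hS₂⟩ <;> rcases hcT with hcT | ⟨hT₁, hT₂⟩
  · exact (hcS.hasPieceCover hv.1 hw).join ((hcT.hasPieceCover hv.2 hu).insert_trivial hv.2) hST
      val_union.symm
  · rw [adjPairs_of_isClique hT₁]
    exact (hcS.hasPieceCover hv.1 hw).join (hasPieceCover_offDiag hv.2 hT₂).1 hST val_union.symm
  · rw [adjPairs_of_isClique hS₁]
    exact (hasPieceCover_offDiag hv.1 hS₂).1.join (hcT.hasPieceCover hv.2 hu) hST val_union'.symm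
  · rw [adjPairs_of_isClique hS₁, adjPairs_of_isClique hT₁]
    exact (hasPieceCover_offDiag hv.1 hS₂).2.2.join (hasPieceCover_offDiag hv.2 hT₂).2.1 hST
      val_union.symm

theorem hasCover_of_isConn [Finite V] (hG : G.IsBlockGraph) (S : Finset V) (hS : IsConn G S) :
    HasCover S (adjPairs G S).val ∨ IsSmallOddClique G S := by
  induction S using Finset.strongInduction with
  | H S ih =>
    by_cases hcut : ∀ v ∈ S, (S.erase v).Nonempty → IsConn G (S.erase v)
    · have hcl := isClique_of_isConn hG hS hcut
      by_cases hcard : S.card = 3 ∨ S.card = 5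
      · exact .inr ⟨hcl, hcard⟩
      · rw [not_or] at hcard
        rw [adjPairs_of_isClique hcl]
        exact .inl (hasCover_offDiag hS.1 hcard.1 hcard.2)
    · left
      simp only [IsConn] at hcut
      push Not at hcut
      obtain ⟨v, hv, hne, hcut⟩ := hcut
      -- `A` is a nonempty proper part of `S.erase v` that no edge leaves within it; `A` and the
      -- remaining part `B`, each with `v` added, are the two sides to be glued.
      obtain ⟨A, hA, hAne, hadj, hAS⟩ := hcut hne
      let B := S.erase v \ A
      have hadjB : ∀ a ∈ B, ∀ b ∈ S.erase v, b ∉ B → ¬ G.Adj a b := by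
        intro a ha b hb hbB hab
        rw [Finset.mem_sdiff] at ha hbB
        have hbA : b ∈ A := by
          by_contra h
          exact hbB ⟨hb, h⟩
        exact hadj b hbA a ha.1 ha.2 hab.symm
      have hB : B ⊆ S.erase v := Finset.sdiff_subset
      have hBne : B.Nonempty := by
        rw [Finset.sdiff_nonempty]
        exact fun h => hAS (hA.antisymm h)
      have hvA : v ∉ A := fun h => by simpa using hA h
      have hvB : v ∉ B := fun h => by simpa using hB h
      have hAB : Disjoint A B := Finset.disjoint_sdiff
      have hunion : insert v A ∪ insert v B = S := by
        rw [← Finset.insert_union_distrib, Finset.union_sdiff_of_subset hA, Finset.insert_erase hv]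
      have hinter : insert v A ∩ insert v B = {v} := by
        rw [← Finset.insert_inter_distrib, Finset.disjoint_iff_inter_eq_empty.1 hAB]
        rfl
      have hne' : ∀ C : Finset V, C.Nonempty → v ∉ C → insert v C ≠ {v} := by
        rintro C ⟨x, hx⟩ hvC h
        have : x ∈ ({v} : Finset V) := h ▸ Finset.mem_insert_of_mem hx
        rw [Finset.mem_singleton] at this
        exact hvC (this ▸ hx)
      have hcA := hS.insert_part hv hA hadj
      have hcB := hS.insert_part hv hB hadjB
      have hlt : ∀ C D : Finset V, D.Nonempty → v ∉ D → Disjoint C D →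
          insert v C ∪ insert v D = S → insert v C ⊂ S := by
        rintro C D ⟨x, hx⟩ hvD hCD rfl
        refine Finset.ssubset_iff_subset_ne.2 ⟨Finset.subset_union_left, fun h => ?_⟩
        have : x ∈ insert v C := by
          rw [h]
          simp [hx]
        rcases Finset.mem_insert.1 this with rfl | h
        · exact hvD hx
        · exact Finset.disjoint_left.1 hCD h hx
      have := hasCover_union hcA hcB hinter (hne' A hAne hvA) (hne' B hBne hvB) ?_
        (ih _ (hlt A B hBne hvB hAB hunion) hcA)
        (ih _ (hlt B A hAne hvA hAB.symm (by rw [Finset.union_comm, hunion])) hcB)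
      · rwa [hunion] at this
      · intro a ha b hb hab
        by_contra! hcon
        rw [Finset.mem_insert, not_or] at hcon
        rw [Finset.mem_insert, not_or] at hcon
        refine hadj a ((Finset.mem_insert.1 ha).resolve_left hcon.1.1) b
          (hB ((Finset.mem_insert.1 hb).resolve_left hcon.2.1)) hcon.2.2 hab

end PathCover

/-! ### From lists to directed paths, and from components to the graph -/

namespace PathCover

open SimpleGraph

variable {V : Type*} {G : SimpleGraph V}

lemma mem_darts_iff {u v : V} (p : G.Walk u v) (d : G.Dart) :
    d ∈ p.darts ↔ d.toProd ∈ arcs p.support := by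
  induction p with
  | nil => simp
  | cons h p ih =>
    rw [Walk.darts_cons, Walk.support_cons, List.mem_cons, ih]
    cases p <;> simp [SimpleGraph.Dart.ext_iff]

/-- The path with the given list of vertices. -/
lemma exists_directedPath {l : List V} (hne : l ≠ []) (hl : l.Nodup)
    (harcs : ∀ e ∈ arcs l, G.Adj e.1 e.2) : ∃ p : G.DirectedPath, p.walk.support = l := by
  have hc : l.IsChain G.Adj := isChain_iff_forall_mem_arcs.2 harcs
  refine ⟨⟨_, _, Walk.ofSupport l hne hc, ?_⟩, Walk.support_ofSupport hne hc⟩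
  rw [Walk.isPath_def, Walk.support_ofSupport]
  exact hl

lemma head?_support (p : G.DirectedPath) : p.walk.support.head? = some p.start := by
  rw [List.head?_eq_some_head p.walk.support_ne_nil, Walk.head_support]

lemma getLast?_support (p : G.DirectedPath) : p.walk.support.getLast? = some p.finish := by
  rw [List.getLast?_eq_some_getLast p.walk.support_ne_nil, Walk.getLast_support]

lemma directedPath_ext {p q : G.DirectedPath} (h : p.walk.support = q.walk.support) : p = q := by
  have hu : p.start = q.start := by
    rw [← Option.some_inj, ← head?_support, ← head?_support, h]
  have hv : p.finish = q.finish := by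
    rw [← Option.some_inj, ← getLast?_support, ← getLast?_support, h]
  obtain ⟨u, v, p, hp⟩ := p
  obtain ⟨u', v', q, hq⟩ := q
  dsimp only at hu hv
  subst hu hv
  obtain rfl : p = q := Walk.ext_support h
  rfl

/-- Passing from a multiset of lists to a set of paths is harmless: arcs, first and last vertices
each form a multiset without repetition, which yields all uniqueness claims. -/
theorem HasCover.hasOPPDC [Fintype V] (h : HasCover Finset.univ (adjPairs G Finset.univ).val) :
    G.HasOPPDC := by
  obtain ⟨F, h⟩ := h
  have hpath : ∀ l ∈ F, ∃ p : G.DirectedPath, p.walk.support = l := by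
    intro l hl
    refine exists_directedPath ?_ (h.nodup l hl) fun e he => ?_
    · rintro rfl
      -- The empty list would contribute `none` to the first entries.
      have : none ∈ (Finset.univ : Finset V).val.map some := by
        rw [← h.heads_eq]
        exact Multiset.mem_map_of_mem List.head? hl
      simp at this
    · have : e ∈ (adjPairs G Finset.univ).val := by
        rw [← h.arcs_eq]
        exact Multiset.mem_bind.2 ⟨l, hl, he⟩
      exact (mem_adjPairs.1 this).2
  have some_nodup : ((Finset.univ : Finset V).val.map some).Nodup :=
    Finset.univ.nodup.map (Option.some_injective V)
  refine ⟨{p | p.walk.support ∈ F}, ?_, ?_, ?_⟩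
  · intro d
    have hd : d.toProd ∈ F.bind fun l => (arcs l : Multiset (V × V)) := by
      rw [h.arcs_eq]
      exact (mem_adjPairs.2 ⟨⟨Finset.mem_univ _, Finset.mem_univ _⟩, d.adj⟩ :
        d.toProd ∈ adjPairs G Finset.univ)
    have hnodup : (F.bind fun l => (arcs l : Multiset (V × V))).Nodup := by
      rw [h.arcs_eq]
      exact Finset.nodup _
    obtain ⟨l, hl, hdl⟩ := Multiset.mem_bind.1 hd
    obtain ⟨p, rfl⟩ := hpath l hl
    refine ⟨p, ⟨hl, (mem_darts_iff _ _).2 hdl⟩, ?_⟩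
    rintro q ⟨hq, hdq⟩
    by_contra hqp
    have hne : q.walk.support ≠ p.walk.support := fun h => hqp (directedPath_ext h)
    obtain ⟨F, rfl⟩ := Multiset.exists_cons_of_mem hl
    have hq' : q.walk.support ∈ F := (Multiset.mem_cons.1 hq).resolve_left hne
    rw [Multiset.cons_bind] at hnodup
    -- Two different paths through `d` would make it occur twice among all arcs.
    exact Multiset.disjoint_left.1 (Multiset.disjoint_of_nodup_add hnodup) hdl
      (Multiset.mem_bind.2 ⟨_, hq', (mem_darts_iff _ _).1 hdq⟩)
  · intro v
    obtain ⟨l, hl, hlv⟩ : ∃ l ∈ F, l.head? = some v := by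
      rw [← Multiset.mem_map, h.heads_eq]
      simp
    obtain ⟨p, rfl⟩ := hpath l hl
    refine ⟨p, ⟨hl, by simpa [head?_support] using hlv⟩, ?_⟩
    rintro q ⟨hq, hqv⟩
    refine directedPath_ext (Multiset.inj_on_of_nodup_map (h.heads_eq ▸ some_nodup) _ hq _ hl ?_)
    rw [hlv, head?_support, hqv]
  · intro v
    obtain ⟨l, hl, hlv⟩ : ∃ l ∈ F, l.getLast? = some v := by
      rw [← Multiset.mem_map, h.lasts_eq]
      simp
    obtain ⟨p, rfl⟩ := hpath l hl
    refine ⟨p, ⟨hl, by simpa [getLast?_support] using hlv⟩, ?_⟩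
    rintro q ⟨hq, hqv⟩
    refine directedPath_ext (Multiset.inj_on_of_nodup_map (h.lasts_eq ▸ some_nodup) _ hq _ hl ?_)
    rw [hlv, getLast?_support, hqv]

/-- The vertices of a connected component. -/
lemma isConn_supp [Fintype V] (c : G.ConnectedComponent) [Fintype c.supp] :
    IsConn G c.supp.toFinset := by
  refine ⟨by simpa using c.nonempty_supp, fun A hA hne hadj => hA.antisymm fun b hb => ?_⟩
  obtain ⟨a, ha⟩ := hne
  by_contra hbA
  have hb' := Set.mem_toFinset.1 hb
  have ha' := Set.mem_toFinset.1 (hA ha)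
  obtain ⟨p⟩ : G.Reachable a b := by
    rw [← ConnectedComponent.eq]
    exact ha'.trans hb'.symm
  obtain ⟨d, -, hd₁, hd₂⟩ := p.exists_boundary_dart A ha hbA
  refine hadj d.fst hd₁ d.snd ?_ hd₂ d.adj
  have := Set.mem_toFinset.1 (hA hd₁)
  rw [Set.mem_toFinset]
  exact (ConnectedComponent.connectedComponentMk_eq_of_adj d.adj).symm.trans this

lemma nonempty_iso_of_isClique [Fintype V] (c : G.ConnectedComponent) [Fintype c.supp]
    (h : G.IsClique c.supp) {n : ℕ} (hn : c.supp.toFinset.card = n) :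
    Nonempty (c.toSimpleGraph ≃g (⊤ : SimpleGraph (Fin n))) := by
  have e : c.supp ≃ Fin n := Fintype.equivFinOfCardEq (by rw [← hn, Set.toFinset_card])
  refine ⟨⟨e, fun {a b} => ?_⟩⟩
  rw [top_adj, e.injective.ne_iff]
  constructor
  · intro hab
    exact h a.2 b.2 fun h => hab (Subtype.ext h)
  · intro hab h
    subst h
    exact SimpleGraph.irrefl _ hab

/-- No edge joins different components, so covers add up, one component at a time. -/
theorem hasCover_univ_of_components [Fintype V] [DecidableEq V]
    (h : ∀ (c : G.ConnectedComponent) (S : Finset V), (∀ v, v ∈ S ↔ G.connectedComponentMk v = c) →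
      HasCover S (adjPairs G S).val) :
    HasCover Finset.univ (adjPairs G Finset.univ).val := by
  classical
  have key : ∀ C : Finset G.ConnectedComponent, ∀ S : Finset V,
      (∀ v, v ∈ S ↔ G.connectedComponentMk v ∈ C) → HasCover S (adjPairs G S).val := by
    intro C
    induction C using Finset.induction_on with
    | empty =>
      intro S hS
      obtain rfl : S = ∅ := Finset.eq_empty_of_forall_notMem fun v hv => by simpa using (hS v).1 hv
      exact ⟨0, by simp, by simp, by simp [adjPairs], by simp, by simp⟩
    | insert c C hc ih =>
      intro S hS
      let S₁ := Finset.univ.filter fun v => G.connectedComponentMk v = c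
      let S₂ := Finset.univ.filter fun v => G.connectedComponentMk v ∈ C
      have hd : Disjoint S₁ S₂ := by
        rw [Finset.disjoint_left]
        intro v hv hv'
        simp only [S₁, S₂, Finset.mem_filter, Finset.mem_univ, true_and] at hv hv'
        exact hc (hv ▸ hv')
      have hu : S = S₁ ∪ S₂ := by
        ext v
        simp [hS, S₁, S₂]
      rw [hu, adjPairs_union (by simp [Finset.disjoint_iff_inter_eq_empty.1 hd])]
      · exact (h c S₁ (by simp [S₁])).disjUnion (ih S₂ (by simp [S₂])) hd
      · intro a ha b hb hab
        left
        simp only [S₂, Finset.mem_filter, Finset.mem_univ, true_and] at hb ⊢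
        rwa [ConnectedComponent.connectedComponentMk_eq_of_adj hab]
  exact key Finset.univ Finset.univ (by simp)

end PathCover

theorem mainTheorem10 {V : Type*} [Finite V] (G : SimpleGraph V)
    (hG : G.IsBlockGraph)
    (h3 : ∀ c : G.ConnectedComponent, ¬ Nonempty (c.toSimpleGraph ≃g (⊤ : SimpleGraph (Fin 3))))
    (h5 : ∀ c : G.ConnectedComponent, ¬ Nonempty (c.toSimpleGraph ≃g (⊤ : SimpleGraph (Fin 5)))) :
    G.HasOPPDC := by
  classical
  have := Fintype.ofFinite V
  refine (PathCover.hasCover_univ_of_components fun c S hS => ?_).hasOPPDC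
  obtain rfl : S = c.supp.toFinset := by
    ext v
    rw [hS, Set.mem_toFinset]
    rfl
  rcases PathCover.hasCover_of_isConn hG _ (PathCover.isConn_supp c) with h | ⟨h, h' | h'⟩
  · exact h
  · exact absurd (PathCover.nonempty_iso_of_isClique c (by simpa using h) h') (h3 c)
  · exact absurd (PathCover.nonempty_iso_of_isClique c (by simpa using h) h') (h5 c)
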